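/- (Thurston) Let $M$ and $B$ be smooth finite-dimensional (Hausdorff, second countable, boundaryless) manifolds and let $p\colon M\to B$ be a fibration, that is, a smooth submersion that admits a complete Ehresmann connection: a smooth splitting $TM=\mathrm{Ver}\oplus\mathrm{Hor}$, where $\mathrm{Ver}:=\ker dp$, such that every smooth curve $\mathbb R\to B$ has, through each point of $M$ above one of its points, a horizontal lift defined on all of $\mathbb R$. For $k\ge 0$ let $\Omega^k(\mathrm{Ver})$ be the space of smooth sections of $\Lambda^k\mathrm{Ver}^*$ (smooth families of $k$-forms on the fibres), and let $d_V\colon\Omega^k(\mathrm{Ver})\to\Omega^{k+1}(\mathrm{Ver})$ be the vertical de Rham differential, given for smooth vertical vector fields $v_0,\dots,v_k$ by $$(d_V\eta)(v_0,\dots,v_k)=\sum_{i}(-1)^i\,v_i\bigl(\eta(v_0,\dots,\widehat{v_i},\dots,v_k)\bigr)+\sum_{i<j}(-1)^{i+j}\,\eta([v_i,v_j],v_0,\dots,\widehat{v_i},\dots,\widehat{v_j},\dots,v_k).$$ Let $H^k(\mathrm{Ver})$ be the degree-$k$ cohomology of $(\Omega^\bullet(\mathrm{Ver}),d_V)$ and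 let $H^k(M)\to H^k(\mathrm{Ver})$ be the map $[\Lambda]\mapsto[\Lambda|_{\Lambda^k\mathrm{Ver}}]$ induced by restriction to the fibres. Let $k\ge 0$ and let $\Theta_V\in\Omega^k(\mathrm{Ver})$ be a smooth family of closed $k$-forms on the fibres, that is, $d_V\Theta_V=0$. Then $\Theta_V$ admits a closed extension, i.e. there is a smooth $k$-form $\Lambda$ on $M$ with $d\Lambda=0$ and $\Lambda|_{\Lambda^k\mathrm{Ver}}=\Theta_V$, if and only if there is a de Rham cohomology class in $H^k(M)$ whose restriction to the fibres is $[\Theta_V]\in H^k(\mathrm{Ver})$. -/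

import Mathlib

open scoped Manifold ContDiff

noncomputable section

namespace FibredForms

open Set
open scoped Topology

variable {E : Type*} [NormedAddCommGroup E] [NormedSpace ℝ E]
  {F : Type*} [NormedAddCommGroup F] [NormedSpace ℝ F]
  {M : Type*} [TopologicalSpace M] [ChartedSpace E M]
  {B : Type*} [TopologicalSpace B] [ChartedSpace F B]

/-! ### Differential forms, exterior derivative and de Rham cohomology of a manifold -/

variable (E M) in
/-- Fields of alternating `k`-linear forms on the tangent spaces of `M`, with no smoothness condition. -/
def RoughForm (k : ℕ) : Type _ :=
  (m : M) → TangentSpace 𝓘(ℝ, E) m [⋀^Fin k]→L[ℝ] ℝ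

instance (k : ℕ) : AddCommGroup (RoughForm E M k) :=
  inferInstanceAs (AddCommGroup ((m : M) → TangentSpace 𝓘(ℝ, E) m [⋀^Fin k]→L[ℝ] ℝ))

instance (k : ℕ) : Module ℝ (RoughForm E M k) :=
  inferInstanceAs (Module ℝ ((m : M) → TangentSpace 𝓘(ℝ, E) m [⋀^Fin k]→L[ℝ] ℝ))

section
variable [IsManifold 𝓘(ℝ, E) ∞ M]

/-- A field of alternating forms, as a section of the bundle `Λᵏ T*M`. -/
def formSection {k : ℕ} (α : RoughForm E M k) (m : M) :
    Bundle.TotalSpace (E [⋀^Fin k]→L[ℝ] ℝ)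
      (fun m : M => TangentSpace 𝓘(ℝ, E) m [⋀^Fin k]→L[ℝ] Bundle.Trivial M ℝ m) :=
  ⟨m, α m⟩

/-- Smoothness on a set `U`, as a section of the bundle `Λᵏ T*M`. -/
def IsSmoothOn {k : ℕ} (α : RoughForm E M k) (U : Set M) : Prop :=
  ContMDiffOn 𝓘(ℝ, E) (𝓘(ℝ, E).prod 𝓘(ℝ, E [⋀^Fin k]→L[ℝ] ℝ)) ∞ (formSection α) U

variable (E M) in
/-- The space `Ωᵏ(M)` of smooth differential `k`-forms on `M`. -/
def smoothForms (k : ℕ) : Submodule ℝ (RoughForm E M k) where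
  carrier := {α | IsSmoothOn α univ}
  add_mem' ha hb := ContMDiffOn.add_section ha hb
  zero_mem' := by
    intro x _
    exact (Bundle.contMDiff_zeroSection ℝ (fun m : M => TangentSpace 𝓘(ℝ, E) m [⋀^Fin k]→L[ℝ] Bundle.Trivial M ℝ m)).contMDiffAt.contMDiffWithinAt
  smul_mem' c _ ha := ContMDiffOn.const_smul_section (a := c) ha
end

/-- The form `α` read in the preferred chart at `x`: its pullback by the inverse of that chart. -/
def chartForm {k : ℕ} (α : RoughForm E M k) (x : M) : E → E [⋀^Fin k]→L[ℝ] ℝ :=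
  fun y => (α ((extChartAt 𝓘(ℝ, E) x).symm y)).compContinuousLinearMap
    (mfderivWithin 𝓘(ℝ, E) 𝓘(ℝ, E) (extChartAt 𝓘(ℝ, E) x).symm (range 𝓘(ℝ, E)) y)

/-- The exterior derivative: at `x`, take the exterior derivative of `α` read in the preferred chart
at `x`, and pull the result back to `M`. -/
def extDerivForm {k : ℕ} (α : RoughForm E M k) : RoughForm E M (k + 1) := fun x =>
  (extDeriv (chartForm α x) (extChartAt 𝓘(ℝ, E) x x)).compContinuousLinearMap
    (mfderiv 𝓘(ℝ, E) 𝓘(ℝ, E) (extChartAt 𝓘(ℝ, E) x) x)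

lemma extDerivForm_smul {k : ℕ} (c : ℝ) (α : RoughForm E M k) :
    extDerivForm (c • α) = c • extDerivForm α := by
  funext x
  have h : chartForm (c • α) x = c • chartForm α x := rfl
  rw [extDerivForm, h, extDeriv_smul]
  rfl

lemma extDerivForm_zero {k : ℕ} : extDerivForm (0 : RoughForm E M k) = 0 := by
  simpa using extDerivForm_smul (0 : ℝ) (0 : RoughForm E M k)

/-- The vector field `X` read in the preferred chart at `x`. -/
def chartField (X : (m : M) → TangentSpace 𝓘(ℝ, E) m) (x : M) : E → E :=
  VectorField.mpullbackWithin 𝓘(ℝ, E) 𝓘(ℝ, E) (extChartAt 𝓘(ℝ, E) x).symm X (range 𝓘(ℝ, E))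

section
variable [IsManifold 𝓘(ℝ, E) ∞ M]

lemma chartForm_chartField {k : ℕ} (α : RoughForm E M k) (X : Fin k → (m : M) → TangentSpace 𝓘(ℝ, E) m)
    (x : M) {y : E} (hy : y ∈ (extChartAt 𝓘(ℝ, E) x).target) :
    chartForm α x y (fun i => chartField (X i) x y) =
      α ((extChartAt 𝓘(ℝ, E) x).symm y) (fun i => X i ((extChartAt 𝓘(ℝ, E) x).symm y)) := by
  have h := isInvertible_mfderivWithin_extChartAt_symm (I := 𝓘(ℝ, E)) hy
  show α _ _ = _
  congr 1
  funext i
  exact h.self_apply_inverse _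

lemma differentiableAt_chartField {X : (m : M) → TangentSpace 𝓘(ℝ, E) m} {x : M}
    [CompleteSpace E]
    (hX : ContMDiffAt 𝓘(ℝ, E) 𝓘(ℝ, E).tangent ∞ (fun m => (⟨m, X m⟩ : TangentBundle 𝓘(ℝ, E) M)) x) :
    DifferentiableAt ℝ (chartField X x) (extChartAt 𝓘(ℝ, E) x x) := by
  have := (hX.mdifferentiableAt (by simp)).mdifferentiableWithinAt (s := univ)
  have h2 : DifferentiableWithinAt ℝ (chartField X x)
      ((extChartAt 𝓘(ℝ, E) x).symm ⁻¹' univ ∩ range 𝓘(ℝ, E)) (extChartAt 𝓘(ℝ, E) x x) :=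
    this.differentiableWithinAt_mpullbackWithin_vectorField
  rwa [preimage_univ, univ_inter, modelWithCornersSelf_coe, range_id,
    differentiableWithinAt_univ] at h2

lemma differentiableAt_chartForm {k : ℕ} {α : RoughForm E M k} {x : M}
    (hα : ContMDiffAt 𝓘(ℝ, E) (𝓘(ℝ, E).prod 𝓘(ℝ, E [⋀^Fin k]→L[ℝ] ℝ)) ∞ (formSection α) x) :
    DifferentiableAt ℝ (chartForm α x) (extChartAt 𝓘(ℝ, E) x x) := by
  have h1 := (Bundle.contMDiffAt_section (IB := 𝓘(ℝ, E)) (F := E [⋀^Fin k]→L[ℝ] ℝ)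
    (E := fun m : M => TangentSpace 𝓘(ℝ, E) m [⋀^Fin k]→L[ℝ] Bundle.Trivial M ℝ m)
    (s := α) x).1 hα
  have h2 := (contMDiffAt_iff.1 h1).2
  have h3 := h2.differentiableWithinAt (by simp)
  rw [modelWithCornersSelf_coe, range_id, differentiableWithinAt_univ] at h3
  refine h3.congr_of_eventuallyEq ?_
  filter_upwards [extChartAt_target_mem_nhds (I := 𝓘(ℝ, E)) x] with y hy
  have hs : (extChartAt 𝓘(ℝ, E) x).symm y ∈ (chartAt E x).source := by
    simpa using (extChartAt 𝓘(ℝ, E) x).map_target hy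
  have h4 := TangentBundle.symmL_trivializationAt (I := 𝓘(ℝ, E)) hs
  rw [(extChartAt 𝓘(ℝ, E) x).right_inv hy] at h4
  ext v
  rw [chartForm, ← h4, extChartAt_model_space_eq_id]
  change _ = (trivializationAt (E [⋀^Fin k]→L[ℝ] ℝ)
    (fun m : M => TangentSpace 𝓘(ℝ, E) m [⋀^Fin k]→L[ℝ] Bundle.Trivial M ℝ m) x
    (formSection α ((extChartAt 𝓘(ℝ, E) x).symm y))).2 v
  rw [FiberBundle.trivializationAt_continuousAlternatingMap_apply]
  simp only [ContinuousAlternatingMap.inCoordinates, Bundle.Trivial.fiberBundle_trivializationAt',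
    Bundle.Trivial.continuousLinearMapAt_trivialization]
  rfl

lemma eventually_chart {k : ℕ} (α : RoughForm E M k) (X : Fin k → (m : M) → TangentSpace 𝓘(ℝ, E) m)
    (x : M) :
    (fun m => α m (fun i => X i m)) =ᶠ[𝓝 x]
      (fun y => chartForm α x y (fun i => chartField (X i) x y)) ∘ (extChartAt 𝓘(ℝ, E) x) := by
  filter_upwards [extChartAt_source_mem_nhds (I := 𝓘(ℝ, E)) x] with m hm
  rw [Function.comp_apply, chartForm_chartField _ _ _ ((extChartAt 𝓘(ℝ, E) x).map_source hm),
    (extChartAt 𝓘(ℝ, E) x).left_inv hm]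

lemma differentiableAt_chart_apply {k : ℕ} {α : RoughForm E M k} {x : M} [CompleteSpace E]
    {X : Fin k → (m : M) → TangentSpace 𝓘(ℝ, E) m} 
    (hα : ContMDiffAt 𝓘(ℝ, E) (𝓘(ℝ, E).prod 𝓘(ℝ, E [⋀^Fin k]→L[ℝ] ℝ)) ∞ (formSection α) x)
    (hX : ∀ i, ContMDiffAt 𝓘(ℝ, E) 𝓘(ℝ, E).tangent ∞ (fun m => (⟨m, X i m⟩ : TangentBundle 𝓘(ℝ, E) M)) x) :
    DifferentiableAt ℝ (fun y => chartForm α x y (fun i => chartField (X i) x y))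
      (extChartAt 𝓘(ℝ, E) x x) := by
  exact (DifferentiableAt.continuousAlternatingMap_apply (differentiableAt_chartForm hα)
    (fun i => differentiableAt_chartField (hX i)))

lemma mdifferentiableAt_apply {k : ℕ} {α : RoughForm E M k} {x : M} [CompleteSpace E]
    {X : Fin k → (m : M) → TangentSpace 𝓘(ℝ, E) m} 
    (hα : ContMDiffAt 𝓘(ℝ, E) (𝓘(ℝ, E).prod 𝓘(ℝ, E [⋀^Fin k]→L[ℝ] ℝ)) ∞ (formSection α) x)
    (hX : ∀ i, ContMDiffAt 𝓘(ℝ, E) 𝓘(ℝ, E).tangent ∞ (fun m => (⟨m, X i m⟩ : TangentBundle 𝓘(ℝ, E) M)) x) :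
    MDifferentiableAt 𝓘(ℝ, E) 𝓘(ℝ, ℝ) (fun m => α m (fun i => X i m)) x :=
  ((differentiableAt_chart_apply hα hX).mdifferentiableAt.comp x
    (mdifferentiableAt_extChartAt (mem_chart_source E x))).congr_of_eventuallyEq
    (eventually_chart α X x)

lemma chartField_self (X : (m : M) → TangentSpace 𝓘(ℝ, E) m) (x : M) :
    chartField X x (extChartAt 𝓘(ℝ, E) x x) = mfderiv 𝓘(ℝ, E) 𝓘(ℝ, E) (extChartAt 𝓘(ℝ, E) x) x (X x) := by
  have h1 := mfderivWithin_extChartAt_symm_inverse_apply (I := 𝓘(ℝ, E)) (x := x) (X x)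
  have h2 := mfderiv_extChartAt_self (I := 𝓘(ℝ, E)) (x := x)
  rw [h2]
  have h3 : X ((extChartAt 𝓘(ℝ, E) x).symm (extChartAt 𝓘(ℝ, E) x x)) = X x := by
    rw [extChartAt_to_inv]
  exact (congrArg (mfderivWithin 𝓘(ℝ, E) 𝓘(ℝ, E) (extChartAt 𝓘(ℝ, E) x).symm (range 𝓘(ℝ, E)) (extChartAt 𝓘(ℝ, E) x x)).inverse h3).trans h1

lemma chartForm_self {k : ℕ} (α : RoughForm E M k) (x : M) (v : Fin k → TangentSpace 𝓘(ℝ, E) x) :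
    chartForm α x (extChartAt 𝓘(ℝ, E) x x)
      (fun i => mfderiv 𝓘(ℝ, E) 𝓘(ℝ, E) (extChartAt 𝓘(ℝ, E) x) x (v i)) = α x v := by
  classical
  have h := chartForm_chartField α (fun i => Function.update 0 x (v i)) x
    (mem_extChartAt_target (I := 𝓘(ℝ, E)) x)
  simp only [chartField_self, Function.update_self] at h
  refine h.trans ?_
  refine (congrArg (fun m => α m (fun i => Function.update (0 : (m : M) → TangentSpace 𝓘(ℝ, E) m)
    x (v i) m)) (extChartAt_to_inv (I := 𝓘(ℝ, E)) x)).trans ?_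
  simp

lemma fderiv_chart_apply {k : ℕ} {α : RoughForm E M k} {x : M} [CompleteSpace E]
    {X : Fin k → (m : M) → TangentSpace 𝓘(ℝ, E) m} 
    (hα : ContMDiffAt 𝓘(ℝ, E) (𝓘(ℝ, E).prod 𝓘(ℝ, E [⋀^Fin k]→L[ℝ] ℝ)) ∞ (formSection α) x)
    (hX : ∀ i, ContMDiffAt 𝓘(ℝ, E) 𝓘(ℝ, E).tangent ∞ (fun m => (⟨m, X i m⟩ : TangentBundle 𝓘(ℝ, E) M)) x)
    (Y : (m : M) → TangentSpace 𝓘(ℝ, E) m) :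
    fderiv ℝ (fun y => chartForm α x y (fun i => chartField (X i) x y)) (extChartAt 𝓘(ℝ, E) x x)
      (chartField Y x (extChartAt 𝓘(ℝ, E) x x)) =
    mvfderiv 𝓘(ℝ, E) (fun m => α m (fun i => X i m)) x (Y x) := by
  have h := (eventually_chart α X x).mfderiv_eq (I := 𝓘(ℝ, E)) (I' := 𝓘(ℝ, ℝ))
  have h2 := mfderiv_comp x (differentiableAt_chart_apply hα hX).mdifferentiableAt
    (mdifferentiableAt_extChartAt (I := 𝓘(ℝ, E)) (mem_chart_source E x))
  rw [mfderiv_eq_fderiv] at h2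
  have h3 := congrArg (fun L => L (Y x)) (h.trans h2)
  rw [chartField_self]
  exact h3.symm

lemma chartForm_bracket {X Y : (m : M) → TangentSpace 𝓘(ℝ, E) m} (x : M) :
  mfderiv 𝓘(ℝ, E) 𝓘(ℝ, E) (extChartAt 𝓘(ℝ, E) x) x (VectorField.mlieBracket 𝓘(ℝ, E) X Y x) =
    VectorField.lieBracket ℝ (chartField X x) (chartField Y x) (extChartAt 𝓘(ℝ, E) x x) := by
  have h := isInvertible_mfderiv_extChartAt (I := 𝓘(ℝ, E)) (mem_extChartAt_source (I := 𝓘(ℝ, E)) x)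
  rw [← VectorField.mlieBracketWithin_univ, VectorField.mlieBracketWithin_apply]
  refine (h.self_apply_inverse _).trans ?_
  change VectorField.lieBracketWithin ℝ (chartField X x) (chartField Y x) 
    ((extChartAt 𝓘(ℝ, E) x).symm ⁻¹' univ ∩ range 𝓘(ℝ, E)) _ = _
  rw [preimage_univ, univ_inter, modelWithCornersSelf_coe, range_id,
    VectorField.lieBracketWithin_univ]

/-- The formula for the exterior derivative of a function along vector fields. -/
lemma extDerivForm_apply_zero [CompleteSpace E] {α : RoughForm E M 0} {x : M}
    (hα : ContMDiffAt 𝓘(ℝ, E) (𝓘(ℝ, E).prod 𝓘(ℝ, E [⋀^Fin 0]→L[ℝ] ℝ)) ∞ (formSection α) x)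
    (X : Fin 1 → (m : M) → TangentSpace 𝓘(ℝ, E) m)
    (hX : ∀ i, ContMDiffAt 𝓘(ℝ, E) 𝓘(ℝ, E).tangent ∞ (fun m => (⟨m, X i m⟩ : TangentBundle 𝓘(ℝ, E) M)) x) :
    extDerivForm α x (fun i => X i x) = 
      ∑ i : Fin 1, (-1) ^ (i : ℕ) * mvfderiv 𝓘(ℝ, E) (fun m => α m (fun l => X (i.succAbove l) m)) x (X i x) := by
  have h : extDerivForm α x (fun i => X i x) = extDeriv (chartForm α x) (extChartAt 𝓘(ℝ, E) x x)
      (fun i => chartField (X i) x (extChartAt 𝓘(ℝ, E) x x)) := by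
    simp only [chartField_self]; rfl
  rw [h, extDeriv_apply_vectorField_of_pairwise_commute (V := fun i => chartField (X i) x) (differentiableAt_chartForm hα)
    (fun i => differentiableAt_chartField (hX i)) (fun i j hij => absurd (Subsingleton.elim (α := Fin 1) i j) hij)]
  refine Finset.sum_congr rfl fun i _ => ?_
  rw [zsmul_eq_mul]
  push_cast
  congr 1
  exact fderiv_chart_apply (X := fun l => X (i.succAbove l)) hα (fun l => hX _) (X i)

/-- The Koszul formula for the exterior derivative on `M`. -/
lemma extDerivForm_apply_succ [CompleteSpace E] {k : ℕ} {α : RoughForm E M (k + 1)} {x : M}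
    (hα : ContMDiffAt 𝓘(ℝ, E) (𝓘(ℝ, E).prod 𝓘(ℝ, E [⋀^Fin (k + 1)]→L[ℝ] ℝ)) ∞ (formSection α) x)
    (X : Fin (k + 2) → (m : M) → TangentSpace 𝓘(ℝ, E) m)
    (hX : ∀ i, ContMDiffAt 𝓘(ℝ, E) 𝓘(ℝ, E).tangent ∞ (fun m => (⟨m, X i m⟩ : TangentBundle 𝓘(ℝ, E) M)) x) :
    extDerivForm α x (fun i => X i x) = 
      ∑ i : Fin (k + 2), (-1) ^ (i : ℕ) * mvfderiv 𝓘(ℝ, E) (fun m => α m (fun l => X (i.succAbove l) m)) x (X i x)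
      + ∑ i : Fin (k + 1), ∑ j ∈ Finset.Ici i, (-1) ^ ((i.castSucc : ℕ) + (j.succ : ℕ)) *
          α x (Fin.cons (VectorField.mlieBracket 𝓘(ℝ, E) (X i.castSucc) (X j.succ) x)
            (fun l => X (i.castSucc.succAbove (j.succAbove l)) x)) := by
  have h : extDerivForm α x (fun i => X i x) = extDeriv (chartForm α x) (extChartAt 𝓘(ℝ, E) x x)
      (fun i => chartField (X i) x (extChartAt 𝓘(ℝ, E) x x)) := by
    simp only [chartField_self]; rfl
  rw [h, extDeriv_apply_vectorField (V := fun i => chartField (X i) x) (differentiableAt_chartForm hα)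
    (fun i => differentiableAt_chartField (hX i)), sub_eq_add_neg, ← Finset.sum_neg_distrib]
  congr 1
  · refine Finset.sum_congr rfl fun i _ => ?_
    rw [zsmul_eq_mul]
    push_cast
    congr 1
    exact fderiv_chart_apply (X := fun l => X (i.succAbove l)) hα (fun l => hX _) (X i)
  · refine Finset.sum_congr rfl fun i _ => ?_
    rw [← Finset.sum_neg_distrib]
    refine Finset.sum_congr rfl fun j _ => ?_
    have : ((i.castSucc : ℕ) + (j.succ : ℕ)) = (i + j : ℕ) + 1 := by simp; ring
    rw [this, pow_succ, zsmul_eq_mul, mul_neg_one, neg_mul]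
    push_cast
    congr 2
    rw [← chartForm_bracket]
    rw [← chartForm_self]
    congr 1
    funext l
    refine Fin.cases rfl (fun l => ?_) l
    exact chartField_self _ _

lemma extDerivForm_add {k : ℕ} {α β : RoughForm E M k} (hα : α ∈ smoothForms E M k)
    (hβ : β ∈ smoothForms E M k) :
    extDerivForm (α + β) = extDerivForm α + extDerivForm β := by
  funext x
  have h : chartForm (α + β) x = chartForm α x + chartForm β x := rfl
  have ha := differentiableAt_chartForm ((hα x (mem_univ x)).contMDiffAt Filter.univ_mem)
  have hb := differentiableAt_chartForm ((hβ x (mem_univ x)).contMDiffAt Filter.univ_mem)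
  rw [extDerivForm, h, extDeriv_add ha hb]
  rfl

variable (E M) in
/-- The space of closed smooth `k`-forms on `M`. -/
def closedForms (k : ℕ) : Submodule ℝ (RoughForm E M k) where
  carrier := {α | α ∈ smoothForms E M k ∧ extDerivForm α = 0}
  add_mem' := fun ha hb => ⟨add_mem ha.1 hb.1, by
    rw [extDerivForm_add ha.1 hb.1, ha.2, hb.2, add_zero]⟩
  zero_mem' := ⟨zero_mem _, extDerivForm_zero⟩
  smul_mem' := fun c α ha => ⟨Submodule.smul_mem _ c ha.1, by
    rw [extDerivForm_smul, ha.2, smul_zero]⟩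

variable (E M) in
/-- The space of exact `k`-forms on `M`: the exterior derivatives of the smooth `(k - 1)`-forms
(only `0` in degree `0`). -/
def exactForms : (k : ℕ) → Submodule ℝ (RoughForm E M k)
  | 0 => ⊥
  | k + 1 =>
    { carrier := {β | ∃ α ∈ smoothForms E M k, extDerivForm α = β}
      add_mem' := by
        rintro _ _ ⟨α, hα, rfl⟩ ⟨β, hβ, rfl⟩
        exact ⟨α + β, add_mem hα hβ, extDerivForm_add hα hβ⟩
      zero_mem' := ⟨0, zero_mem _, extDerivForm_zero⟩
      smul_mem' := by
        rintro c _ ⟨α, hα, rfl⟩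
        exact ⟨c • α, Submodule.smul_mem _ c hα, extDerivForm_smul c α⟩ }

variable (E M) in
/-- The de Rham cohomology `Hᵏ(M)`: closed forms modulo exact forms. -/
abbrev DeRhamCohomology (k : ℕ) : Type _ :=
  closedForms E M k ⧸ (exactForms E M k).submoduleOf (closedForms E M k)

end

/-! ### Fibrations -/

/-- The fibre at `m` of the vertical bundle `Ver = ker dp`. -/
def ver (p : C^∞⟮𝓘(ℝ, E), M; 𝓘(ℝ, F), B⟯) (m : M) : Submodule ℝ (TangentSpace 𝓘(ℝ, E) m) :=
  LinearMap.ker (mfderiv 𝓘(ℝ, E) 𝓘(ℝ, F) p m).toLinearMap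

/-- An Ehresmann connection: a smooth splitting `TM = Ver ⊕ Hor`, given by the smooth field of
projectors of `TM` onto `Ver` along `Hor`; the horizontal space at `m` is `ker (proj m)`. -/
structure EhresmannConnection (p : C^∞⟮𝓘(ℝ, E), M; 𝓘(ℝ, F), B⟯) [IsManifold 𝓘(ℝ, E) ∞ M] where
  proj : (m : M) → TangentSpace 𝓘(ℝ, E) m →L[ℝ] TangentSpace 𝓘(ℝ, E) m
  isProj : ∀ m, LinearMap.IsProj (ver p m) (proj m).toLinearMap
  smooth : ContMDiff 𝓘(ℝ, E) (𝓘(ℝ, E).prod 𝓘(ℝ, E →L[ℝ] E)) ∞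
    (fun m => Bundle.TotalSpace.mk' (E →L[ℝ] E)
      (E := fun m : M => TangentSpace 𝓘(ℝ, E) m →L[ℝ] TangentSpace 𝓘(ℝ, E) m) m (proj m))

/-- A smooth curve in `M` is horizontal if its velocity is horizontal at all times. -/
def EhresmannConnection.IsHorizontal {p : C^∞⟮𝓘(ℝ, E), M; 𝓘(ℝ, F), B⟯} [IsManifold 𝓘(ℝ, E) ∞ M]
    (H : EhresmannConnection p) (c : ℝ → M) : Prop :=
  ∀ t : ℝ, H.proj (c t) (mfderiv 𝓘(ℝ, ℝ) 𝓘(ℝ, E) c t (1 : ℝ)) = 0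

/-- An Ehresmann connection is complete if every smooth curve of the base has, through every point
above each of its points, a horizontal lift that is defined at all times. -/
def EhresmannConnection.IsComplete {p : C^∞⟮𝓘(ℝ, E), M; 𝓘(ℝ, F), B⟯} [IsManifold 𝓘(ℝ, E) ∞ M]
    (H : EhresmannConnection p) : Prop :=
  ∀ c : ℝ → B, ContMDiff 𝓘(ℝ, ℝ) 𝓘(ℝ, F) ∞ c → ∀ (t₀ : ℝ) (m : M), p m = c t₀ →
    ∃ c' : ℝ → M, ContMDiff 𝓘(ℝ, ℝ) 𝓘(ℝ, E) ∞ c' ∧ c' t₀ = m ∧ (∀ t, p (c' t) = c t) ∧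
      H.IsHorizontal c'

/-- A fibration: a smooth submersion that admits a complete Ehresmann connection. -/
structure IsFibration (p : C^∞⟮𝓘(ℝ, E), M; 𝓘(ℝ, F), B⟯) [IsManifold 𝓘(ℝ, E) ∞ M] : Prop where
  submersion : ∀ m, Function.Surjective (mfderiv 𝓘(ℝ, E) 𝓘(ℝ, F) p m)
  exists_connection : ∃ H : EhresmannConnection p, H.IsComplete

/-! ### Vertical forms, vertical differential and vertical cohomology -/

/-- A smooth vertical vector field, that is, a smooth section of `Ver`. -/
structure VerticalField (p : C^∞⟮𝓘(ℝ, E), M; 𝓘(ℝ, F), B⟯) [IsManifold 𝓘(ℝ, E) ∞ M] where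
  toFun : (m : M) → ver p m
  smooth : ContMDiff 𝓘(ℝ, E) 𝓘(ℝ, E).tangent ∞
    (fun m => (⟨m, (toFun m : TangentSpace 𝓘(ℝ, E) m)⟩ : TangentBundle 𝓘(ℝ, E) M))

section
variable [IsManifold 𝓘(ℝ, E) ∞ M] [IsManifold 𝓘(ℝ, F) ∞ B]

lemma eventually_fderiv_chart_eq_zero (p : C^∞⟮𝓘(ℝ, E), M; 𝓘(ℝ, F), B⟯) (X : VerticalField p) (x : M) :
    ∀ᶠ y in 𝓝 (extChartAt 𝓘(ℝ, E) x x),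
      fderiv ℝ (extChartAt 𝓘(ℝ, F) (p x) ∘ p ∘ (extChartAt 𝓘(ℝ, E) x).symm) y
        (chartField (fun m => X.toFun m) x y) = 0 := by
  have hc : ContinuousAt (p ∘ (extChartAt 𝓘(ℝ, E) x).symm) (extChartAt 𝓘(ℝ, E) x x) :=
    p.contMDiff.continuous.continuousAt.comp (continuousAt_extChartAt_symm x)
  have h2 : (chartAt F (p x)).source ∈ 𝓝 ((p ∘ (extChartAt 𝓘(ℝ, E) x).symm) (extChartAt 𝓘(ℝ, E) x x)) := by
    rw [Function.comp_apply, extChartAt_to_inv]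
    exact chart_source_mem_nhds F (p x)
  filter_upwards [extChartAt_target_mem_nhds (I := 𝓘(ℝ, E)) x, hc h2] with y hy hy2
  have hs : MDifferentiableAt 𝓘(ℝ, E) 𝓘(ℝ, E) (extChartAt 𝓘(ℝ, E) x).symm y := by
    have := mdifferentiableWithinAt_extChartAt_symm (I := 𝓘(ℝ, E)) hy
    rwa [modelWithCornersSelf_coe, range_id, mdifferentiableWithinAt_univ] at this
  have hp : MDifferentiableAt 𝓘(ℝ, E) 𝓘(ℝ, F) p ((extChartAt 𝓘(ℝ, E) x).symm y) :=
    p.contMDiff.contMDiffAt.mdifferentiableAt (by simp)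
  have hψ := mdifferentiableAt_extChartAt (I := 𝓘(ℝ, F)) hy2
  have hinv := (isInvertible_mfderivWithin_extChartAt_symm (I := 𝓘(ℝ, E)) hy).self_apply_inverse
    (X.toFun ((extChartAt 𝓘(ℝ, E) x).symm y) : TangentSpace 𝓘(ℝ, E) ((extChartAt 𝓘(ℝ, E) x).symm y))
  have hX := LinearMap.mem_ker.1 (X.toFun ((extChartAt 𝓘(ℝ, E) x).symm y)).2
  have e1 := mfderiv_comp y (hψ) (hp.comp y hs)
  have e2 := mfderiv_comp y hp hs
  rw [e2, mfderiv_eq_fderiv] at e1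
  obtain ⟨v, hv⟩ : ∃ v : E, v = chartField (E := E)
    (fun m => (X.toFun m : TangentSpace 𝓘(ℝ, E) m)) x y := ⟨_, rfl⟩
  have e3 := congrArg (fun L : E →L[ℝ] F => L v) e1
  have h6 : mfderivWithin 𝓘(ℝ, E) 𝓘(ℝ, E) (extChartAt 𝓘(ℝ, E) x).symm (range 𝓘(ℝ, E)) y
      = mfderiv 𝓘(ℝ, E) 𝓘(ℝ, E) (extChartAt 𝓘(ℝ, E) x).symm y := by
    rw [modelWithCornersSelf_coe, range_id, mfderivWithin_univ]
  have h4 : mfderiv 𝓘(ℝ, E) 𝓘(ℝ, E) (extChartAt 𝓘(ℝ, E) x).symm y v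
      = X.toFun ((extChartAt 𝓘(ℝ, E) x).symm y) := by
    rw [← h6, hv]
    exact hinv
  have h5 : mfderiv 𝓘(ℝ, E) 𝓘(ℝ, F) p ((extChartAt 𝓘(ℝ, E) x).symm y)
      (mfderiv 𝓘(ℝ, E) 𝓘(ℝ, E) (extChartAt 𝓘(ℝ, E) x).symm y v) = 0 := by
    rw [h4]; exact hX
  rw [← hv]
  exact e3.trans ((congrArg (mfderiv 𝓘(ℝ, F) 𝓘(ℝ, F) (extChartAt 𝓘(ℝ, F) (p x))
    (p ((extChartAt 𝓘(ℝ, E) x).symm y))) h5).trans (map_zero _))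

lemma mlieBracket_mem_ver [FiniteDimensional ℝ E] (p : C^∞⟮𝓘(ℝ, E), M; 𝓘(ℝ, F), B⟯)
    (X Y : VerticalField p) (x : M) :
    VectorField.mlieBracket 𝓘(ℝ, E) (fun m => (X.toFun m : TangentSpace 𝓘(ℝ, E) m))
      (fun m => (Y.toFun m : TangentSpace 𝓘(ℝ, E) m)) x ∈ ver p x := by
  have := FiniteDimensional.complete ℝ E
  have hf : ContDiffAt ℝ ∞ (extChartAt 𝓘(ℝ, F) (p x) ∘ p ∘ (extChartAt 𝓘(ℝ, E) x).symm)
      (extChartAt 𝓘(ℝ, E) x x) := by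
    have := (contMDiffAt_iff.1 (p.contMDiff x)).2
    rwa [modelWithCornersSelf_coe, range_id, contDiffWithinAt_univ] at this
  have h1 := VectorField.fderiv_apply_lieBracket hf (by simp; norm_cast)
    (differentiableAt_chartField (Y.smooth x)) (differentiableAt_chartField (X.smooth x))
  rw [Filter.EventuallyEq.fderiv_eq (eventually_fderiv_chart_eq_zero p X x),
    Filter.EventuallyEq.fderiv_eq (eventually_fderiv_chart_eq_zero p Y x)] at h1
  rw [← chartForm_bracket, fderiv_fun_const] at h1
  have hev : (extChartAt 𝓘(ℝ, F) (p x) ∘ p ∘ (extChartAt 𝓘(ℝ, E) x).symm) ∘ extChartAt 𝓘(ℝ, E) x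
      =ᶠ[𝓝 x] extChartAt 𝓘(ℝ, F) (p x) ∘ p := by
    filter_upwards [extChartAt_source_mem_nhds (I := 𝓘(ℝ, E)) x] with m hm
    simp only [Function.comp_apply, (extChartAt 𝓘(ℝ, E) x).left_inv hm]
  have h2 := hev.mfderiv_eq (I := 𝓘(ℝ, E)) (I' := 𝓘(ℝ, F))
  rw [mfderiv_comp x (hf.differentiableAt (by simp)).mdifferentiableAt
    (mdifferentiableAt_extChartAt (mem_chart_source E x)), mfderiv_eq_fderiv,
    mfderiv_comp x (mdifferentiableAt_extChartAt (mem_chart_source F (p x)))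
      (p.contMDiff.contMDiffAt.mdifferentiableAt (by simp)),
    mfderiv_extChartAt_self (I := 𝓘(ℝ, F))] at h2
  refine LinearMap.mem_ker.2 ?_
  refine (congrArg (fun L => L (VectorField.mlieBracket 𝓘(ℝ, E)
    (fun m => (X.toFun m : TangentSpace 𝓘(ℝ, E) m))
    (fun m => (Y.toFun m : TangentSpace 𝓘(ℝ, E) m)) x)) h2).symm.trans ?_
  refine h1.trans ?_
  exact sub_self _

/-- The Lie bracket of two vertical vector fields, as a field of vertical vectors. -/
def verticalBracket [FiniteDimensional ℝ E] {p : C^∞⟮𝓘(ℝ, E), M; 𝓘(ℝ, F), B⟯}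
    (X Y : VerticalField p) (m : M) : ver p m :=
  ⟨VectorField.mlieBracket 𝓘(ℝ, E) (fun m => (X.toFun m : TangentSpace 𝓘(ℝ, E) m))
    (fun m => (Y.toFun m : TangentSpace 𝓘(ℝ, E) m)) m, mlieBracket_mem_ver p X Y m⟩

end

/-- Fields of alternating `k`-linear forms on the vertical spaces, with no smoothness condition. -/
def RoughVerticalForm (p : C^∞⟮𝓘(ℝ, E), M; 𝓘(ℝ, F), B⟯) (k : ℕ) : Type _ :=
  (m : M) → ver p m [⋀^Fin k]→L[ℝ] ℝ

instance (p : C^∞⟮𝓘(ℝ, E), M; 𝓘(ℝ, F), B⟯) (k : ℕ) : AddCommGroup (RoughVerticalForm p k) :=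
  inferInstanceAs (AddCommGroup ((m : M) → ver p m [⋀^Fin k]→L[ℝ] ℝ))

instance (p : C^∞⟮𝓘(ℝ, E), M; 𝓘(ℝ, F), B⟯) (k : ℕ) : Module ℝ (RoughVerticalForm p k) :=
  inferInstanceAs (Module ℝ ((m : M) → ver p m [⋀^Fin k]→L[ℝ] ℝ))

/-- The restriction of the `k`-forms on `M` to `Λᵏ Ver`, that is, to the fibres. -/
def restrictForm (p : C^∞⟮𝓘(ℝ, E), M; 𝓘(ℝ, F), B⟯) (k : ℕ) :
    RoughForm E M k →ₗ[ℝ] RoughVerticalForm p k where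
  toFun α m := (α m).compContinuousLinearMap (ver p m).subtypeL
  map_add' _ _ := rfl
  map_smul' _ _ := rfl

section
variable [IsManifold 𝓘(ℝ, E) ∞ M]

/-- The space `Ωᵏ(Ver)` of smooth families of `k`-forms on the fibres, that is, of smooth sections
of `Λᵏ Ver*`. As this bundle is the quotient of `Λᵏ T*M` under restriction to `Ver`, a section
of it is smooth when, locally, it is the restriction of a smooth `k`-form on an open subset of `M`. -/
def smoothVerticalForms (p : C^∞⟮𝓘(ℝ, E), M; 𝓘(ℝ, F), B⟯) (k : ℕ) :
    Submodule ℝ (RoughVerticalForm p k) where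
  carrier := {η | ∀ m : M, ∃ U : Set M, IsOpen U ∧ m ∈ U ∧
    ∃ β : RoughForm E M k, IsSmoothOn β U ∧ ∀ x ∈ U, η x = restrictForm p k β x}
  add_mem' := by
    intro η η' h h' m
    obtain ⟨U, hU, hm, β, hβ, he⟩ := h m
    obtain ⟨U', hU', hm', β', hβ', he'⟩ := h' m
    refine ⟨U ∩ U', hU.inter hU', ⟨hm, hm'⟩, β + β',
      ContMDiffOn.add_section (hβ.mono inter_subset_left) (hβ'.mono inter_subset_right), ?_⟩
    intro x hx
    exact congrArg₂ (· + ·) (he x hx.1) (he' x hx.2)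
  zero_mem' := fun m => ⟨univ, isOpen_univ, mem_univ m, 0, zero_mem (smoothForms E M k),
    fun x _ => by rw [map_zero]⟩
  smul_mem' := by
    intro c η h m
    obtain ⟨U, hU, hm, β, hβ, he⟩ := h m
    refine ⟨U, hU, hm, c • β, ContMDiffOn.const_smul_section (a := c) hβ, ?_⟩
    intro x hx
    exact congrArg (c • ·) (he x hx)

lemma restrictForm_mem_smooth (p : C^∞⟮𝓘(ℝ, E), M; 𝓘(ℝ, F), B⟯) {k : ℕ} {α : RoughForm E M k}
    (hα : α ∈ smoothForms E M k) : restrictForm p k α ∈ smoothVerticalForms p k :=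
  fun m => ⟨univ, isOpen_univ, mem_univ m, α, hα, fun _ _ => rfl⟩

lemma mdifferentiableAt_vertical_apply [FiniteDimensional ℝ E] {p : C^∞⟮𝓘(ℝ, E), M; 𝓘(ℝ, F), B⟯}
    {k : ℕ} {η : RoughVerticalForm p k} (hη : η ∈ smoothVerticalForms p k)
    (X : Fin k → VerticalField p) (m : M) :
    MDifferentiableAt 𝓘(ℝ, E) 𝓘(ℝ, ℝ) (fun x => η x (fun l => (X l).toFun x)) m := by
  have := FiniteDimensional.complete ℝ E
  obtain ⟨U, hU, hm, β, hβ, he⟩ := hη m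
  refine (mdifferentiableAt_apply ((hβ m hm).contMDiffAt (hU.mem_nhds hm))
    (fun l => (X l).smooth m)).congr_of_eventuallyEq ?_
  filter_upwards [hU.mem_nhds hm] with x hx
  rw [he x hx]
  rfl

variable [IsManifold 𝓘(ℝ, F) ∞ B] [FiniteDimensional ℝ E]
  {p : C^∞⟮𝓘(ℝ, E), M; 𝓘(ℝ, F), B⟯}

/-- The sum `∑_{a < b} (-1)^(a + b) η([X_a, X_b], X_0, …, X̂_a, …, X̂_b, …, X_k)` over the pairs
`a < b` in `{0, …, k}`, written as `a = i`, `b = j + 1` with `i ≤ j`; it is empty for `k = 0`. -/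
def bracketSum : {k : ℕ} → RoughVerticalForm p k → (Fin (k + 1) → VerticalField p) → M → ℝ
  | 0, _, _, _ => 0
  | k + 1, η, X, m => ∑ i : Fin (k + 1), ∑ j ∈ Finset.Ici i,
      (-1) ^ ((i.castSucc : ℕ) + (j.succ : ℕ)) *
        η m (Fin.cons (verticalBracket (X i.castSucc) (X j.succ) m)
          (fun l => (X (i.castSucc.succAbove (j.succAbove l))).toFun m))

/-- The value at `m` of `(d_V η)(X_0, …, X_k)`, for a vertical `k`-form `η` and vertical fields `X_i`:
`∑_i (-1)^i X_i(η(X_0, …, X̂_i, …, X_k))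
  + ∑_{i < j} (-1)^(i + j) η([X_i, X_j], X_0, …, X̂_i, …, X̂_j, …, X_k)`. -/
def koszulFormula {k : ℕ} (η : RoughVerticalForm p k) (X : Fin (k + 1) → VerticalField p) (m : M) : ℝ :=
  ∑ i : Fin (k + 1), (-1) ^ (i : ℕ) *
      mvfderiv 𝓘(ℝ, E) (fun x => η x (fun l => (X (i.succAbove l)).toFun x)) m ((X i).toFun m)
    + bracketSum η X m

/-- `IsVerticalDifferential η ξ` says that `ξ = d_V η`, where `d_V` is the vertical de Rham
differential, given by its values on the smooth vertical vector fields. -/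
def IsVerticalDifferential {k : ℕ} (η : RoughVerticalForm p k) (ξ : RoughVerticalForm p (k + 1)) : Prop :=
  ∀ (X : Fin (k + 1) → VerticalField p) (m : M),
    ξ m (fun i => (X i).toFun m) = koszulFormula η X m

lemma koszulFormula_add {k : ℕ} {η η' : RoughVerticalForm p k} (h : η ∈ smoothVerticalForms p k)
    (h' : η' ∈ smoothVerticalForms p k) (X : Fin (k + 1) → VerticalField p) (m : M) :
    koszulFormula (η + η') X m = koszulFormula η X m + koszulFormula η' X m := by
  have h1 : bracketSum (η + η') X m = bracketSum η X m + bracketSum η' X m := by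
    cases k with
    | zero => simp [bracketSum]
    | succ k =>
      simp only [bracketSum, ← Finset.sum_add_distrib, ← mul_add]
      rfl
  rw [koszulFormula, koszulFormula, koszulFormula, h1, add_add_add_comm, ← Finset.sum_add_distrib]
  congr 1
  refine Finset.sum_congr rfl fun i _ => ?_
  rw [← mul_add]
  congr 1
  exact congrArg (fun L : TangentSpace 𝓘(ℝ, E) m →L[ℝ] ℝ => L ((X i).toFun m)) (mvfderiv_add
    (mdifferentiableAt_vertical_apply h (fun l => X (i.succAbove l)) m)
    (mdifferentiableAt_vertical_apply h' (fun l => X (i.succAbove l)) m))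

lemma koszulFormula_smul {k : ℕ} (c : ℝ) {η : RoughVerticalForm p k}
    (h : η ∈ smoothVerticalForms p k) (X : Fin (k + 1) → VerticalField p) (m : M) :
    koszulFormula (c • η) X m = c * koszulFormula η X m := by
  have h1 : bracketSum (c • η) X m = c * bracketSum η X m := by
    cases k with
    | zero => simp [bracketSum]
    | succ k =>
      simp only [bracketSum, Finset.mul_sum]
      refine Finset.sum_congr rfl fun i _ => Finset.sum_congr rfl fun j _ => ?_
      rw [mul_left_comm]
      rfl
  rw [koszulFormula, koszulFormula, h1, mul_add, Finset.mul_sum]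
  congr 1
  refine Finset.sum_congr rfl fun i _ => ?_
  rw [mul_left_comm]
  congr 1
  have hs := mvfderiv_smul (mdifferentiableAt_const (I := 𝓘(ℝ, E)) (I' := 𝓘(ℝ, ℝ)) (c := c))
    (mdifferentiableAt_vertical_apply h (fun l => X (i.succAbove l)) m)
  rw [mvfderiv_const] at hs
  refine (congrArg (fun L : TangentSpace 𝓘(ℝ, E) m →L[ℝ] ℝ => L ((X i).toFun m)) hs).trans ?_
  simp

lemma isVerticalDifferential_zero {k : ℕ} :
    IsVerticalDifferential (0 : RoughVerticalForm p k) 0 := by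
  intro X m
  have h := koszulFormula_smul (0 : ℝ) (zero_mem (smoothVerticalForms p k)) X m
  rw [zero_smul, zero_mul] at h
  rw [h]
  rfl

/-- Restriction to the fibres intertwines the differential of `M` and the vertical one. -/
lemma isVerticalDifferential_restrictForm {k : ℕ} {α : RoughForm E M k}
    (hα : α ∈ smoothForms E M k) :
    IsVerticalDifferential (restrictForm p k α) (restrictForm p (k + 1) (extDerivForm α)) := by
  have := FiniteDimensional.complete ℝ E
  intro X m
  have hm := (hα m (mem_univ m)).contMDiffAt Filter.univ_mem
  cases k with
  | zero =>
    rw [koszulFormula, bracketSum, add_zero]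
    exact extDerivForm_apply_zero hm (fun i m => (X i).toFun m) (fun i => (X i).smooth m)
  | succ k =>
    refine (extDerivForm_apply_succ hm (fun i m => (X i).toFun m)
      (fun i => (X i).smooth m)).trans ?_
    rw [koszulFormula, bracketSum]
    congr 1
    refine Finset.sum_congr rfl fun i _ => Finset.sum_congr rfl fun j _ => ?_
    congr 1
    refine congrArg (α m) ?_
    funext l
    exact Fin.cases rfl (fun _ => rfl) l

variable (p)

/-- The space of smooth families of closed `k`-forms on the fibres. -/
def closedVerticalForms (k : ℕ) : Submodule ℝ (RoughVerticalForm p k) where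
  carrier := {η | η ∈ smoothVerticalForms p k ∧ IsVerticalDifferential η 0}
  add_mem' := fun ha hb => ⟨add_mem ha.1 hb.1, fun X m => by
    rw [koszulFormula_add ha.1 hb.1, ← ha.2 X m, ← hb.2 X m]
    exact (add_zero _).symm⟩
  zero_mem' := ⟨zero_mem _, isVerticalDifferential_zero⟩
  smul_mem' := fun c η ha => ⟨Submodule.smul_mem _ c ha.1, fun X m => by
    rw [koszulFormula_smul c ha.1, ← ha.2 X m]
    exact (mul_zero c).symm⟩

/-- The space of vertically exact `k`-forms: the vertical differentials of the smooth vertical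
`(k - 1)`-forms (only `0` in degree `0`). -/
def exactVerticalForms : (k : ℕ) → Submodule ℝ (RoughVerticalForm p k)
  | 0 => ⊥
  | k + 1 =>
    { carrier := {ξ | ∃ η ∈ smoothVerticalForms p k, IsVerticalDifferential η ξ}
      add_mem' := by
        rintro ξ ξ' ⟨η, hη, h⟩ ⟨η', hη', h'⟩
        refine ⟨η + η', add_mem hη hη', fun X m => ?_⟩
        rw [koszulFormula_add hη hη', ← h X m, ← h' X m]
        rfl
      zero_mem' := ⟨0, zero_mem _, isVerticalDifferential_zero⟩
      smul_mem' := by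
        rintro c ξ ⟨η, hη, h⟩
        refine ⟨c • η, Submodule.smul_mem _ c hη, fun X m => ?_⟩
        rw [koszulFormula_smul c hη, ← h X m]
        rfl }

/-- The vertical cohomology `Hᵏ(Ver)`: vertically closed forms modulo vertically exact forms. -/
abbrev VerticalCohomology (k : ℕ) : Type _ :=
  closedVerticalForms p k ⧸ (exactVerticalForms p k).submoduleOf (closedVerticalForms p k)

/-- The class `[Θ] ∈ Hᵏ(Ver)` of a smooth family `Θ` of closed forms on the fibres. -/
def verticalClass {k : ℕ} (Θ : closedVerticalForms p k) : VerticalCohomology p k :=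
  Submodule.Quotient.mk Θ

lemma restrictForm_mem_closed {k : ℕ} {α : RoughForm E M k} (hα : α ∈ closedForms E M k) :
    restrictForm p k α ∈ closedVerticalForms p k := by
  refine ⟨restrictForm_mem_smooth p hα.1, ?_⟩
  have h := isVerticalDifferential_restrictForm (p := p) hα.1
  rwa [hα.2, map_zero] at h

/-- The restriction to the fibres, on closed forms. -/
def restrictClosed (k : ℕ) : closedForms E M k →ₗ[ℝ] closedVerticalForms p k :=
  (restrictForm p k).restrict fun _ hα => restrictForm_mem_closed p hα

lemma restrictForm_mem_exact {k : ℕ} {β : RoughForm E M k} (hβ : β ∈ exactForms E M k) :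
    restrictForm p k β ∈ exactVerticalForms p k := by
  cases k with
  | zero =>
    have h0 : β = 0 := hβ
    rw [h0, map_zero]
    exact zero_mem _
  | succ k =>
    obtain ⟨α, hα, rfl⟩ := hβ
    exact ⟨restrictForm p k α, restrictForm_mem_smooth p hα, isVerticalDifferential_restrictForm hα⟩

/-- The restriction to the fibres `Hᵏ(M) → Hᵏ(Ver)`, `[Λ] ↦ [Λ|_Ver]`. -/
def restrictCohomology (k : ℕ) : DeRhamCohomology E M k →ₗ[ℝ] VerticalCohomology p k :=
  Submodule.mapQ _ _ (restrictClosed p k) fun _ hβ => restrictForm_mem_exact p hβ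

end
end FibredForms

end

open scoped Manifold ContDiff

noncomputable section

namespace FibredForms

open Set Filter
open scoped Topology

/-! A closed extension of `Θ` is itself a closed form whose class restricts to `[Θ]`, which gives
one direction. Conversely, let `Λ` be a closed form representing a class that restricts to `[Θ]`.
Then `Θ - Λ|_Ver` is vertically exact, say `d_V η` (or zero in degree 0). It suffices to lift this
error to an exact form on `M`: extend `η` to a smooth form `α` on `M`; restriction intertwines the
two differentials, so `dα` restricts to `d_V η`, and `Λ + dα` is a closed extension of `Θ`.

Three facts carry this. `exists_restrictForm_eq` extends `η` by a partition of unity: the extensions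
of `η` at a point form an affine space. `isVerticalDifferential_unique` identifies `dα|_Ver` with
the given `d_V η`: the Koszul formula prescribes values on smooth vertical fields only, so every
vertical vector must extend to such a field, obtained by projecting an arbitrary extension with the
connection. Finally, `exactForms_le_closedForms` says that `dα` is smooth and closed. Because
`extDerivForm` uses a different chart at each point, this rests on its independence of the chart,
`extDerivForm_eq_of_mem_source`, which comes from the naturality of `extDeriv` under pullback. -/

/-! ### Smooth families of alternating forms on a vector space. -/

lemma contDiffAt_extDeriv {E : Type*} [NormedAddCommGroup E] [NormedSpace ℝ E] {k : ℕ}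
    {f : E → E [⋀^Fin k]→L[ℝ] ℝ} {y : E} (h : ContDiffAt ℝ ∞ f y) :
    ContDiffAt ℝ ∞ (extDeriv f) y := by
  have hL : ContDiff ℝ ∞ (ContinuousAlternatingMap.alternatizeUncurryFinCLM ℝ E ℝ (n := k)) := by
    apply ContinuousLinearMap.contDiff
  exact hL.contDiffAt.comp y (h.fderiv_right (m := ∞) (by simp))

section Alternating

variable {D E : Type*} [NormedAddCommGroup D] [NormedSpace ℝ D]
  [NormedAddCommGroup E] [NormedSpace ℝ E] [FiniteDimensional ℝ E]

/-- A map into alternating forms on a finite-dimensional space is smooth if its evaluations are. -/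
lemma contDiffAt_alternating_of_apply {k : ℕ} {n : WithTop ℕ∞} {f : D → E [⋀^Fin k]→L[ℝ] ℝ} {x : D}
    (h : ∀ v : Fin k → E, ContDiffAt ℝ n (fun y => f y v) x) : ContDiffAt ℝ n f x := by
  let b := Module.finBasis ℝ E
  -- An alternating form is determined by its values on tuples of basis vectors, so `L` has a linear
  -- left inverse `G`. The domain of `G` is finite-dimensional, hence `G` is continuous, and `f = G
  -- ∘ L ∘ f` is smooth because `L ∘ f` is.
  let L : (E [⋀^Fin k]→L[ℝ] ℝ) →ₗ[ℝ] ((Fin k → Fin (Module.finrank ℝ E)) → ℝ) :=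
    { toFun := fun a s => a (fun i => b (s i))
      map_add' := fun _ _ => rfl
      map_smul' := fun _ _ => rfl }
  have hL : LinearMap.ker L = ⊥ := by
    refine LinearMap.ker_eq_bot.2 fun a a' haa => ?_
    refine ContinuousAlternatingMap.toContinuousMultilinearMap_injective ?_
    refine ContinuousMultilinearMap.toMultilinearMap_injective ?_
    exact Module.Basis.ext_multilinear (fun _ => b) fun s => congrFun haa s
  obtain ⟨G, hG⟩ := L.exists_leftInverse_of_injective hL
  have hf : f = fun y => LinearMap.toContinuousLinearMap G (L (f y)) := by
    funext y
    exact (LinearMap.congr_fun hG (f y)).symm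
  rw [hf]
  refine (ContinuousLinearMap.contDiff _).contDiffAt.comp x ?_
  exact contDiffAt_pi.2 fun s => h _

lemma contDiffAt_compContinuousLinearMap {k : ℕ} {n : WithTop ℕ∞} {E' : Type*}
    [NormedAddCommGroup E'] [NormedSpace ℝ E'] {f : D → E' [⋀^Fin k]→L[ℝ] ℝ}
    {g : D → E →L[ℝ] E'} {x : D} (hf : ContDiffAt ℝ n f x) (hg : ContDiffAt ℝ n g x) :
    ContDiffAt ℝ n (fun y => (f y).compContinuousLinearMap (g y)) x := by
  refine contDiffAt_alternating_of_apply fun v => ?_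
  -- Pullback of a form is multilinear in the `k` copies of the linear map and linear in the form;
  -- `T` packages this, so smoothness reduces to that of continuous multilinear maps.
  let T := ContinuousMultilinearMap.compContinuousLinearMapContinuousMultilinear ℝ
    (fun _ : Fin k => E) (fun _ : Fin k => E') ℝ
  have hT : ContDiff ℝ n T := by apply ContinuousMultilinearMap.contDiff
  have h1 : ContDiffAt ℝ n (fun y => T fun _ => g y) x :=
    hT.contDiffAt.comp x (contDiffAt_pi.2 fun _ => hg)
  have h2 : ContDiffAt ℝ n (fun y => (f y).toContinuousMultilinearMap) x :=
    (ContinuousAlternatingMap.toContinuousMultilinearMapCLM ℝ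
      (ι := Fin k) (E := E') (F := ℝ) (𝕜 := ℝ)).contDiff.contDiffAt.comp x hf
  exact (ContinuousMultilinearMap.apply ℝ (fun _ : Fin k => E) ℝ v).contDiff.contDiffAt.comp x
    (h1.clm_apply h2)

end Alternating

/-! ### Changes of chart and smoothness of forms. -/

variable {E : Type*} [NormedAddCommGroup E] [NormedSpace ℝ E]
  {M : Type*} [TopologicalSpace M] [ChartedSpace E M]

variable (E) in
/-- The change of coordinates from the preferred chart at `x'` to the one at `x`. -/
def coordChange (x x' : M) : E → E := extChartAt 𝓘(ℝ, E) x ∘ (extChartAt 𝓘(ℝ, E) x').symm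

lemma coordChange_apply {x x' m : M} (h' : m ∈ (extChartAt 𝓘(ℝ, E) x').source) :
    coordChange E x x' (extChartAt 𝓘(ℝ, E) x' m) = extChartAt 𝓘(ℝ, E) x m := by
  rw [coordChange, Function.comp_apply, (extChartAt 𝓘(ℝ, E) x').left_inv h']

lemma eventually_mem_source {x x' m : M} (h : m ∈ (extChartAt 𝓘(ℝ, E) x).source)
    (h' : m ∈ (extChartAt 𝓘(ℝ, E) x').source) :
    ∀ᶠ y in 𝓝 (extChartAt 𝓘(ℝ, E) x' m), y ∈ (extChartAt 𝓘(ℝ, E) x').target ∧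
      (extChartAt 𝓘(ℝ, E) x').symm y ∈ (extChartAt 𝓘(ℝ, E) x).source := by
  refine Filter.Eventually.and ((isOpen_extChartAt_target (I := 𝓘(ℝ, E)) x').mem_nhds
    ((extChartAt 𝓘(ℝ, E) x').map_source h')) ?_
  refine (continuousAt_extChartAt_symm' (I := 𝓘(ℝ, E)) h').eventually (p := fun z => z ∈ _) ?_
  rw [(extChartAt 𝓘(ℝ, E) x').left_inv h']
  exact (isOpen_extChartAt_source (I := 𝓘(ℝ, E)) x).mem_nhds h

/-- The type of `α m` depends on `m`, which obstructs rewriting the base point. Every tangent space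
is `E` by definition, so both sides can be read as forms on `E` and compared there. -/
lemma compContinuousLinearMap_congr {k : ℕ} (α : RoughForm E M k) {m m' : M} (h : m = m')
    {A A' : E →L[ℝ] E} (hA : A = A') :
    (show E [⋀^Fin k]→L[ℝ] ℝ from α m).compContinuousLinearMap A =
      (show E [⋀^Fin k]→L[ℝ] ℝ from α m').compContinuousLinearMap A' := by
  subst h; rw [hA]

variable [IsManifold 𝓘(ℝ, E) ∞ M]

/-- A field of forms is smooth at `x` exactly when its expression in the chart at `x` is. -/
lemma contMDiffAt_formSection_iff {k : ℕ} {α : RoughForm E M k} {x : M} :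
    ContMDiffAt 𝓘(ℝ, E) (𝓘(ℝ, E).prod 𝓘(ℝ, E [⋀^Fin k]→L[ℝ] ℝ)) ∞ (formSection α) x ↔
      ContDiffAt ℝ ∞ (chartForm α x) (extChartAt 𝓘(ℝ, E) x x) := by
  have h1 := Bundle.contMDiffAt_section (IB := 𝓘(ℝ, E)) (F := E [⋀^Fin k]→L[ℝ] ℝ) (n := ∞)
    (E := fun m : M => TangentSpace 𝓘(ℝ, E) m [⋀^Fin k]→L[ℝ] Bundle.Trivial M ℝ m)
    (s := α) x
  refine h1.trans ?_
  set e := trivializationAt (E [⋀^Fin k]→L[ℝ] ℝ)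
    (fun m : M => TangentSpace 𝓘(ℝ, E) m [⋀^Fin k]→L[ℝ] Bundle.Trivial M ℝ m) x with he
  -- The inverse of the tangent bundle trivialization at `x` is the derivative of the inverse chart,
  -- so the trivialization of the form bundle reads `α` as `chartForm α x`.
  have key : chartForm α x =ᶠ[𝓝 (extChartAt 𝓘(ℝ, E) x x)]
      (fun m => (e (formSection α m)).2) ∘ (extChartAt 𝓘(ℝ, E) x).symm := by
    filter_upwards [extChartAt_target_mem_nhds (I := 𝓘(ℝ, E)) x] with y hy
    have hs : (extChartAt 𝓘(ℝ, E) x).symm y ∈ (chartAt E x).source := by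
      simpa using (extChartAt 𝓘(ℝ, E) x).map_target hy
    have h4 := TangentBundle.symmL_trivializationAt (I := 𝓘(ℝ, E)) hs
    rw [(extChartAt 𝓘(ℝ, E) x).right_inv hy] at h4
    ext v
    rw [chartForm, ← h4, Function.comp_apply, he,
      FiberBundle.trivializationAt_continuousAlternatingMap_apply]
    simp only [ContinuousAlternatingMap.inCoordinates,
      Bundle.Trivial.fiberBundle_trivializationAt',
      Bundle.Trivial.continuousLinearMapAt_trivialization]
    rfl
  have key2 : (fun m => (e (formSection α m)).2) =ᶠ[𝓝 x]
      chartForm α x ∘ extChartAt 𝓘(ℝ, E) x := by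
    filter_upwards [(continuousAt_extChartAt (I := 𝓘(ℝ, E)) x).eventually key,
      extChartAt_source_mem_nhds (I := 𝓘(ℝ, E)) x] with m hm hs
    rw [Function.comp_apply, hm, Function.comp_apply, (extChartAt 𝓘(ℝ, E) x).left_inv hs]
  constructor
  · intro h
    have h3 := (contMDiffAt_iff.1 h).2
    rw [modelWithCornersSelf_coe, range_id, contDiffWithinAt_univ] at h3
    exact h3.congr_of_eventuallyEq key
  · intro h
    exact (h.contMDiffAt.comp x contMDiffAt_extChartAt).congr_of_eventuallyEq key2

lemma contDiffAt_coordChange {x x' m : M} (h : m ∈ (extChartAt 𝓘(ℝ, E) x).source)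
    (h' : m ∈ (extChartAt 𝓘(ℝ, E) x').source) :
    ContDiffAt ℝ ∞ (coordChange E x x') (extChartAt 𝓘(ℝ, E) x' m) := by
  have := contDiffWithinAt_ext_coord_change (I := 𝓘(ℝ, E)) (n := ∞) x x'
    (y := extChartAt 𝓘(ℝ, E) x' m) (by
      rw [PartialEquiv.trans_source, PartialEquiv.symm_source]
      refine ⟨(extChartAt 𝓘(ℝ, E) x').map_source h', ?_⟩
      rwa [mem_preimage, (extChartAt 𝓘(ℝ, E) x').left_inv h'])
  rwa [modelWithCornersSelf_coe, range_id, contDiffWithinAt_univ] at this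

lemma mdifferentiableAt_extChartAt_symm {x : M} {y : E} (hy : y ∈ (extChartAt 𝓘(ℝ, E) x).target) :
    MDifferentiableAt 𝓘(ℝ, E) 𝓘(ℝ, E) (extChartAt 𝓘(ℝ, E) x).symm y := by
  have := mdifferentiableWithinAt_extChartAt_symm (I := 𝓘(ℝ, E)) hy
  rwa [modelWithCornersSelf_coe, range_id, mdifferentiableWithinAt_univ] at this

/-- The expressions of a form in two charts are related by pullback along the change of
coordinates. -/
lemma chartForm_coordChange {k : ℕ} (α : RoughForm E M k) {x x' m : M}
    (h : m ∈ (extChartAt 𝓘(ℝ, E) x).source) (h' : m ∈ (extChartAt 𝓘(ℝ, E) x').source) :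
    chartForm α x' =ᶠ[𝓝 (extChartAt 𝓘(ℝ, E) x' m)] fun y =>
      (chartForm α x (coordChange E x x' y)).compContinuousLinearMap
        (fderiv ℝ (coordChange E x x') y) := by
  -- The chart conditions are needed on a neighbourhood of `y`, not only at `y`: the chain rule
  -- below differentiates an identity of germs.
  filter_upwards [(eventually_mem_source h h').eventually_nhds] with y hy
  have hy0 := hy.self_of_nhds
  have hsrc : (extChartAt 𝓘(ℝ, E) x).symm (coordChange E x x' y) =
      (extChartAt 𝓘(ℝ, E) x').symm y := (extChartAt 𝓘(ℝ, E) x).left_inv hy0.2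
  have hev : (extChartAt 𝓘(ℝ, E) x).symm ∘ coordChange E x x' =ᶠ[𝓝 y]
      (extChartAt 𝓘(ℝ, E) x').symm := by
    filter_upwards [hy] with z hz
    exact (extChartAt 𝓘(ℝ, E) x).left_inv hz.2
  have hd : ContDiffAt ℝ ∞ (coordChange E x x') y := by
    have := contDiffAt_coordChange hy0.2 ((extChartAt 𝓘(ℝ, E) x').map_target hy0.1)
    rwa [(extChartAt 𝓘(ℝ, E) x').right_inv hy0.1] at this
  have hcomp := mfderiv_comp (I := 𝓘(ℝ, E)) (I' := 𝓘(ℝ, E)) (I'' := 𝓘(ℝ, E)) y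
    (mdifferentiableAt_extChartAt_symm (x := x) (y := coordChange E x x' y)
      ((extChartAt 𝓘(ℝ, E) x).map_source hy0.2))
    (hd.differentiableAt (by simp)).mdifferentiableAt
  rw [hev.mfderiv_eq, mfderiv_eq_fderiv] at hcomp
  simp only [chartForm, modelWithCornersSelf_coe, range_id, mfderivWithin_univ]
  exact compContinuousLinearMap_congr α hsrc.symm hcomp

/-- Smoothness at `m` is known in the chart at `m`; pulling back along the smooth change of
coordinates carries it to any preferred chart around `m`. -/
lemma contDiffAt_chartForm [FiniteDimensional ℝ E] {k : ℕ} {α : RoughForm E M k} {x m : M}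
    (hα : ContMDiffAt 𝓘(ℝ, E) (𝓘(ℝ, E).prod 𝓘(ℝ, E [⋀^Fin k]→L[ℝ] ℝ)) ∞ (formSection α) m)
    (hm : m ∈ (extChartAt 𝓘(ℝ, E) x).source) :
    ContDiffAt ℝ ∞ (chartForm α x) (extChartAt 𝓘(ℝ, E) x m) := by
  have hc := contDiffAt_coordChange (mem_extChartAt_source (I := 𝓘(ℝ, E)) m) hm
  refine ContDiffAt.congr_of_eventuallyEq ?_
    (chartForm_coordChange α (mem_extChartAt_source (I := 𝓘(ℝ, E)) m) hm)
  refine contDiffAt_compContinuousLinearMap ?_ (hc.fderiv_right (m := ∞) (by simp))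
  refine ContDiffAt.comp (g := chartForm α m) _ ?_ hc
  rw [coordChange_apply hm]
  exact contMDiffAt_formSection_iff.1 hα

/-! ### The exterior derivative in a fixed chart, and `d ∘ d = 0`. -/

/-- The exterior derivative may be computed in any of the preferred charts. -/
lemma extDerivForm_eq_of_mem_source [FiniteDimensional ℝ E] {k : ℕ} {α : RoughForm E M k}
    (hα : α ∈ smoothForms E M k) {x m : M} (hm : m ∈ (extChartAt 𝓘(ℝ, E) x).source) :
    extDerivForm α m = (extDeriv (chartForm α x) (extChartAt 𝓘(ℝ, E) x m)).compContinuousLinearMap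
      (mfderiv 𝓘(ℝ, E) 𝓘(ℝ, E) (extChartAt 𝓘(ℝ, E) x) m) := by
  have hmm := mem_extChartAt_source (I := 𝓘(ℝ, E)) m
  have hc := contDiffAt_coordChange hm hmm
  have hd := (contDiffAt_chartForm ((hα m (mem_univ m)).contMDiffAt univ_mem) hm).differentiableAt
    (by simp)
  -- Naturality of `extDeriv` turns the change of coordinates between the charts at `m` and `x` into
  -- a pullback of the derivative computed in the chart at `x`.
  have h1 := extDeriv_pullback (r := ∞) (f := coordChange E x m)
    (x := extChartAt 𝓘(ℝ, E) m m) (by rwa [← coordChange_apply hmm] at hd) hc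
    (by simp; norm_cast)
  have h2 : extDeriv (chartForm α m) (extChartAt 𝓘(ℝ, E) m m) = extDeriv (fun y =>
      (chartForm α x (coordChange E x m y)).compContinuousLinearMap
        (fderiv ℝ (coordChange E x m) y)) (extChartAt 𝓘(ℝ, E) m m) := by
    rw [extDeriv, extDeriv, (chartForm_coordChange α hm hmm).fderiv_eq]
  have hev : coordChange E x m ∘ extChartAt 𝓘(ℝ, E) m =ᶠ[𝓝 m] extChartAt 𝓘(ℝ, E) x := by
    filter_upwards [extChartAt_source_mem_nhds (I := 𝓘(ℝ, E)) m] with z hz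
    exact coordChange_apply hz
  have hcomp := mfderiv_comp (I := 𝓘(ℝ, E)) (I' := 𝓘(ℝ, E)) (I'' := 𝓘(ℝ, E)) m
    (hc.differentiableAt (by simp)).mdifferentiableAt
    (mdifferentiableAt_extChartAt (I := 𝓘(ℝ, E)) (mem_chart_source E m))
  rw [hev.mfderiv_eq, mfderiv_eq_fderiv] at hcomp
  rw [extDerivForm, h2, h1, coordChange_apply hmm, hcomp]
  rfl

/-- In one fixed chart, `extDerivForm α` is the ordinary exterior derivative on a whole
neighbourhood, although its definition changes chart from point to point. Smoothness of `dα` and `d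
∘ d = 0` thereby reduce to statements on `E`. -/
lemma chartForm_extDerivForm [FiniteDimensional ℝ E] {k : ℕ} {α : RoughForm E M k}
    (hα : α ∈ smoothForms E M k) (x : M) :
    chartForm (extDerivForm α) x =ᶠ[𝓝 (extChartAt 𝓘(ℝ, E) x x)] extDeriv (chartForm α x) := by
  filter_upwards [extChartAt_target_mem_nhds (I := 𝓘(ℝ, E)) x] with y hy
  have h := extDerivForm_eq_of_mem_source hα ((extChartAt 𝓘(ℝ, E) x).map_target hy)
  rw [chartForm, h, (extChartAt 𝓘(ℝ, E) x).right_inv hy]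
  -- The pullbacks by the chart and by its inverse cancel.
  have hi := mfderiv_extChartAt_comp_mfderivWithin_extChartAt_symm (I := 𝓘(ℝ, E)) hy
  ext v
  refine congrArg (extDeriv (chartForm α x) y) ?_
  funext i
  exact congrArg (fun L : E →L[ℝ] E => L (v i)) hi

lemma extDerivForm_mem_smooth [FiniteDimensional ℝ E] {k : ℕ} {α : RoughForm E M k}
    (hα : α ∈ smoothForms E M k) : extDerivForm α ∈ smoothForms E M (k + 1) := by
  intro x _
  refine ContMDiffAt.contMDiffWithinAt (contMDiffAt_formSection_iff.2 ?_)
  exact (contDiffAt_extDeriv (contMDiffAt_formSection_iff.1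
    ((hα x (mem_univ x)).contMDiffAt univ_mem))).congr_of_eventuallyEq (chartForm_extDerivForm hα x)

lemma extDerivForm_extDerivForm [FiniteDimensional ℝ E] {k : ℕ} {α : RoughForm E M k}
    (hα : α ∈ smoothForms E M k) : extDerivForm (extDerivForm α) = 0 := by
  funext x
  have h := contMDiffAt_formSection_iff.1 ((hα x (mem_univ x)).contMDiffAt univ_mem)
  have h2 : extDeriv (chartForm (extDerivForm α) x) (extChartAt 𝓘(ℝ, E) x x) = 0 := by
    rw [extDeriv, (chartForm_extDerivForm hα x).fderiv_eq]
    exact extDeriv_extDeriv_apply h (by simp; norm_cast)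
  rw [extDerivForm, h2]
  rfl

lemma exactForms_le_closedForms [FiniteDimensional ℝ E] (k : ℕ) :
    exactForms E M k ≤ closedForms E M k := by
  cases k with
  | zero => exact bot_le
  | succ k =>
    rintro _ ⟨α, hα, rfl⟩
    exact ⟨extDerivForm_mem_smooth hα, extDerivForm_extDerivForm hα⟩

/-! ### Extension from the vertical bundle to `M`. -/

variable {F : Type*} [NormedAddCommGroup F] [NormedSpace ℝ F]
  {B : Type*} [TopologicalSpace B] [ChartedSpace F B]
  [FiniteDimensional ℝ E] [T2Space M] [SecondCountableTopology M]

/-- Every smooth vertical form is the restriction of a smooth form. -/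
lemma exists_restrictForm_eq {p : C^∞⟮𝓘(ℝ, E), M; 𝓘(ℝ, F), B⟯} {k : ℕ} {η : RoughVerticalForm p k}
    (hη : η ∈ smoothVerticalForms p k) : ∃ β ∈ smoothForms E M k, restrictForm p k β = η := by
  have : LocallyCompactSpace M := Manifold.locallyCompact_of_finiteDimensional 𝓘(ℝ, E)
  -- The forms at `m` with prescribed restriction `η m` form a convex set, so the local extensions
  -- given by the definition of smoothness are glued by a partition of unity.
  obtain ⟨s, hs⟩ := exists_contMDiffSection_forall_mem_convex_of_local (n := ⊤) 𝓘(ℝ, E)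
    (F_fiber := E [⋀^Fin k]→L[ℝ] ℝ)
    (fun m : M => TangentSpace 𝓘(ℝ, E) m [⋀^Fin k]→L[ℝ] Bundle.Trivial M ℝ m)
    (fun m => {a | ContinuousAlternatingMap.compContinuousLinearMap
      (show TangentSpace 𝓘(ℝ, E) m [⋀^Fin k]→L[ℝ] ℝ from a) (ver p m).subtypeL = η m})
    (fun m a ha b hb s t _ _ hst => by
      have h : s • η m + t • η m = η m := by rw [← add_smul, hst, one_smul]
      refine Eq.trans ?_ h
      exact congrArg₂ (fun u w => s • u + t • w) ha hb)
    (fun m => by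
      obtain ⟨U, hU, hm, β, hβ, he⟩ := hη m
      exact ⟨U, hU.mem_nhds hm, β, hβ, fun y hy => (he y hy).symm⟩)
  exact ⟨fun m => s m, s.contMDiff.contMDiffOn, funext hs⟩

/-- Every tangent vector extends to a smooth vector field. -/
lemma exists_vectorField_eq (m : M) (v : TangentSpace 𝓘(ℝ, E) m) :
    ∃ X : (m : M) → TangentSpace 𝓘(ℝ, E) m, ContMDiff 𝓘(ℝ, E) 𝓘(ℝ, E).tangent ∞
      (fun m => (⟨m, X m⟩ : TangentBundle 𝓘(ℝ, E) M)) ∧ X m = v := by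
  have : LocallyCompactSpace M := Manifold.locallyCompact_of_finiteDimensional 𝓘(ℝ, E)
  obtain ⟨s, hs⟩ := exists_contMDiffSection_forall_mem_convex_of_local (n := ⊤) 𝓘(ℝ, E)
    (F_fiber := E) (fun m : M => TangentSpace 𝓘(ℝ, E) m)
    -- The constraint is vacuous away from `m` and forces the value `v` at `m`, so the zero field
    -- serves as local solution on the complement of `m`.
    (fun x => {w | ∀ h : m = x, w = h ▸ v})
    (fun x a ha b hb s t _ _ hst h => by
      rw [ha h, hb h, ← add_smul, hst, one_smul])
    (fun x => by
      by_cases hx : m = x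
      · subst hx
        obtain ⟨U, hU, h⟩ := FiberBundle.exists_contMDiffOn_extend (k := ∞) 𝓘(ℝ, E) E v
        exact ⟨U, hU, _, h, fun y _ h => by subst h; simp⟩
      · exact ⟨{m}ᶜ, isOpen_compl_singleton.mem_nhds (Ne.symm hx), fun _ => 0,
          (Bundle.contMDiff_zeroSection ℝ (fun m : M => TangentSpace 𝓘(ℝ, E) m)).contMDiffOn,
          fun y hy h => absurd h.symm hy⟩)
  exact ⟨s, s.contMDiff, hs m rfl⟩

/-- Every vertical vector extends to a smooth vertical vector field. -/
lemma EhresmannConnection.exists_verticalField_eq {p : C^∞⟮𝓘(ℝ, E), M; 𝓘(ℝ, F), B⟯}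
    (H : EhresmannConnection p) (m : M) (v : ver p m) :
    ∃ X : VerticalField p, X.toFun m = v := by
  obtain ⟨X, hX, hv⟩ := exists_vectorField_eq m (v : TangentSpace 𝓘(ℝ, E) m)
  -- Projecting an arbitrary smooth extension onto `Ver` keeps it smooth and leaves its value at
  -- `m`, already vertical, unchanged.
  refine ⟨⟨fun x => ⟨H.proj x (X x), (H.isProj x).map_mem _⟩, ?_⟩, Subtype.ext ?_⟩
  · exact H.smooth.clm_bundle_apply hX
  · change H.proj m (X m) = v
    rw [hv]
    exact (H.isProj m).map_id _ v.2

variable [IsManifold 𝓘(ℝ, F) ∞ B]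

/-- The vertical differential of a vertical form is unique. -/
lemma EhresmannConnection.isVerticalDifferential_unique {p : C^∞⟮𝓘(ℝ, E), M; 𝓘(ℝ, F), B⟯}
    (H : EhresmannConnection p) {k : ℕ} {η : RoughVerticalForm p k}
    {ξ ξ' : RoughVerticalForm p (k + 1)} (h : IsVerticalDifferential η ξ)
    (h' : IsVerticalDifferential η ξ') : ξ = ξ' := by
  funext m
  refine ContinuousAlternatingMap.ext fun v => ?_
  choose X hX using fun i => H.exists_verticalField_eq m (v i)
  have := (h X m).trans (h' X m).symm
  simpa only [hX] using this

/-- Vertically exact forms are restrictions of exact forms. -/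
lemma EhresmannConnection.exists_exact_restrictForm_eq {p : C^∞⟮𝓘(ℝ, E), M; 𝓘(ℝ, F), B⟯}
    (H : EhresmannConnection p) {k : ℕ} {ξ : RoughVerticalForm p k}
    (hξ : ξ ∈ exactVerticalForms p k) : ∃ β ∈ exactForms E M k, restrictForm p k β = ξ := by
  cases k with
  | zero => exact ⟨0, zero_mem _, (map_zero _).trans (show ξ = 0 from hξ).symm⟩
  | succ k =>
    obtain ⟨η, hη, h⟩ := hξ
    obtain ⟨α, hα, rfl⟩ := exists_restrictForm_eq hη
    -- Both `ξ` and the restriction of `dα` are vertical differentials of `α|_Ver`, hence equal.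
    exact ⟨extDerivForm α, ⟨α, hα, rfl⟩,
      H.isVerticalDifferential_unique (isVerticalDifferential_restrictForm hα) h⟩

end FibredForms

end

/-! ### Closed extensions and cohomology classes. -/

theorem mainTheorem3
    {E : Type*} [NormedAddCommGroup E] [NormedSpace ℝ E] [FiniteDimensional ℝ E]
    {F : Type*} [NormedAddCommGroup F] [NormedSpace ℝ F] [FiniteDimensional ℝ F]
    {M : Type*} [TopologicalSpace M] [ChartedSpace E M] [IsManifold 𝓘(ℝ, E) ∞ M]
    [T2Space M] [SecondCountableTopology M]
    {B : Type*} [TopologicalSpace B] [ChartedSpace F B] [IsManifold 𝓘(ℝ, F) ∞ B]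
    [T2Space B] [SecondCountableTopology B]
    (p : C^∞⟮𝓘(ℝ, E), M; 𝓘(ℝ, F), B⟯) (hp : FibredForms.IsFibration p)
    (k : ℕ) (Θ : FibredForms.closedVerticalForms p k) :
    (∃ Λ ∈ FibredForms.closedForms E M k,
        FibredForms.restrictForm p k Λ = (Θ : FibredForms.RoughVerticalForm p k)) ↔
      ∃ c : FibredForms.DeRhamCohomology E M k,
        FibredForms.restrictCohomology p k c = FibredForms.verticalClass p Θ := by
  constructor
  · rintro ⟨Λ, hΛ, h⟩
    refine ⟨Submodule.Quotient.mk ⟨Λ, hΛ⟩, ?_⟩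
    exact congrArg (FibredForms.verticalClass p) (Subtype.ext h)
  · rintro ⟨c, hc⟩
    obtain ⟨Λ, rfl⟩ := Submodule.Quotient.mk_surjective _ c
    obtain ⟨H, -⟩ := hp.exists_connection
    -- Equality of classes in the quotient means that the representatives differ by a vertically
    -- exact form.
    have hex : (Θ : FibredForms.RoughVerticalForm p k) - FibredForms.restrictForm p k Λ ∈
        FibredForms.exactVerticalForms p k := by
      exact (Submodule.Quotient.eq ((FibredForms.exactVerticalForms p k).submoduleOf
        (FibredForms.closedVerticalForms p k))).1 hc.symm
    obtain ⟨β, hβ, h⟩ := H.exists_exact_restrictForm_eq hex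
    -- The correction `β` is exact, hence closed, and restricts to the error `Θ - Λ|_Ver`.
    exact ⟨Λ + β, add_mem Λ.2 (FibredForms.exactForms_le_closedForms k hβ), by
      rw [map_add, h, add_sub_cancel]⟩
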